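/- Work in ZFC. A space $X$ is \emph{selectively pseudocompact} if for every sequence $(U_n)_{n\in\omega}$ of nonempty open subsets of $X$ there are points $x_n\in U_n$ $(n\in\omega)$, a point $x\in X$ and a free ultrafilter $p$ on $\omega$ such that $x$ is a $p$-limit of $(x_n)_{n\in\omega}$, i.e. $\{n\in\omega : x_n\in U\}\in p$ for every neighbourhood $U$ of $x$. It is \emph{countably pracompact} if it has a dense subset $D$ such that every infinite subset of $D$ has an accumulation point in $X$. There is a Hausdorff selectively pseudocompact Boolean topological group that is not countably pracompact and not separable. In particular, selective pseudocompactness and countable pracompactness are not equivalent for Hausdorff topological groups. More precisely, let $\kappa$ be any set of cardinality $\mathfrak c$ (for example $\kappa=\mathfrak c$), and let $[\kappa]^{<\omega}$ be the group of finite subsets of $\kappa$ under symmetric difference, which is Boolean. Call $F:\kappa\times\kappa\to 2=\{0,1\}$ a \emph{switching function} if (a) for every countable $A\subseteq\kappa$ there is $\beta\in\kappa$ with $F(\alpha,\beta)=1$ for all $\alpha\in A$; (b) for every countable $B\subseteq\kappa$ there are $\alpha_0,\alpha_1\in\kappa$ with $F(\alpha_0,\beta)=0$ and $F(\alpha_1,\beta)=1$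 for all $\beta\in B$. Then switching functions exist. Moreover there are partitions $(I_\alpha)_{\alpha\in\kappa}$ and $(J_\beta)_{\beta\in\kappa}$ of $\kappa$ into sets of cardinality $\mathfrak c$ and homomorphisms $\psi_\mu:[\kappa]^{<\omega}\to\mathbb Z/2$ $(\mu\in\kappa)$ such that the following holds for every switching function $F$. Let $\overline{\sigma_\mu}:[\kappa]^{<\omega}\to\mathbb Z/2$ be the homomorphism given, for $\mu\in I_\alpha$ and $\xi\in J_\beta$, by $$\overline{\sigma_\mu}(\{\xi\})=\begin{cases}0, & F(\alpha,\beta)=0,\\ \psi_\mu(\{\xi\}), & F(\alpha,\beta)=1,\end{cases}$$ and let $\tau$ be the weakest topology on $[\kappa]^{<\omega}$ making every $\overline{\sigma_\mu}$ $(\mu\in\kappa)$ continuous, where $\mathbb Z/2$ is discrete. Then $([\kappa]^{<\omega},\tau)$ is a Hausdorff topological group that is selectively pseudocompact, not countably pracompact and not separable. -/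

import Mathlib

open Set Filter Topology

/-- A free (non-principal) ultrafilter on the natural numbers. -/
def IsFreeUltrafilter (p : Ultrafilter ℕ) : Prop :=
  ∀ n : ℕ, p ≠ pure n

/-- The point `a` is a `p`-limit of the sequence `x`. -/
def IsPLimit {X : Type*} [TopologicalSpace X] (p : Ultrafilter ℕ) (x : ℕ → X) (a : X) : Prop :=
  ∀ U ∈ 𝓝 a, {n : ℕ | x n ∈ U} ∈ p

/-- Selective pseudocompactness: from every sequence of nonempty open sets one can select points
forming a sequence that has a `p`-limit for some free ultrafilter `p`. -/
def SelectivelyPseudocompact (X : Type*) [TopologicalSpace X] : Prop :=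
  ∀ U : ℕ → Set X, (∀ n, IsOpen (U n) ∧ (U n).Nonempty) →
    ∃ (x : ℕ → X) (a : X) (p : Ultrafilter ℕ),
      IsFreeUltrafilter p ∧ IsPLimit p x a ∧ ∀ n, x n ∈ U n

/-- Countable pracompactness: there is a dense set `D` all of whose infinite subsets have an
accumulation point in the space. -/
def CountablyPracompact (X : Type*) [TopologicalSpace X] : Prop :=
  ∃ D : Set X, Dense D ∧ ∀ S ⊆ D, S.Infinite → ∃ a : X, AccPt a (𝓟 S)

/-- The group `[κ]^{<ω}` of finite subsets of `κ`. Its addition is the symmetric difference and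
its zero is the empty set. -/
abbrev FinsetGroup (κ : Type*) : Type _ := AsBoolRing (Finset κ)

namespace FinsetGroup

/-- The element `{ξ}` of `[κ]^{<ω}`. -/
def single {κ : Type*} (ξ : κ) : FinsetGroup κ := toBoolRing ({ξ} : Finset κ)

theorem add_eq_symmDiff {κ : Type*} [DecidableEq κ] (x y : FinsetGroup κ) :
    x + y = toBoolRing (symmDiff (ofBoolRing x) (ofBoolRing y)) := rfl

theorem zero_eq_empty {κ : Type*} [DecidableEq κ] :
    (0 : FinsetGroup κ) = toBoolRing (∅ : Finset κ) := rfl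

end FinsetGroup

/-- The covering properties of the switching function `F : κ × κ → 2`: every countable set of rows
is switched on in some common column, every countable set of columns is switched off in some common
row, and every countable set of columns is switched on in some common row. -/
def IsSwitchingFunction {κ : Type*} (F : κ × κ → Fin 2) : Prop :=
  (∀ A : Set κ, A.Countable → ∃ β, ∀ α ∈ A, F (α, β) = 1) ∧
  (∀ B : Set κ, B.Countable →
    (∃ α₀, ∀ β ∈ B, F (α₀, β) = 0) ∧ (∃ α₁, ∀ β ∈ B, F (α₁, β) = 1))

/-- The weakest topology on `G` making every homomorphism of the family `σ` into the discrete
two-element group continuous. -/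
abbrev homTopology {G ι : Type*} [AddCommGroup G] (σ : ι → (G →+ ZMod 2)) : TopologicalSpace G :=
  ⨅ i, TopologicalSpace.induced (σ i) ⊥

/-!
The group `[κ]^{<ω}` is free over `ZMod 2` on its singletons, so a family of homomorphisms into
`ZMod 2` is the same thing as a matrix of values on pairs (row, point), and the matrix may be chosen
at will. The points of `κ` are coded as triples `(β, t, k)`: `β` is the column, `t` a sequence of
finite requests on the values of the characters, and `k` is either a natural number or `none`. At
`(β, t, some n)` the characters mentioned in `t n` take the requested values, and at `(β, t, none)`
each character takes the limit along a fixed free ultrafilter of its values at `(β, t, some n)`.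
The rows are coded as triples (row class, background, label). The background prescribes
the values that no request determines, as a superposition of `probe`s, which respect the limits.

*Selective pseudocompactness.* A sequence of basic open sets is a sequence of requests `t`. It
involves only countably many row classes, so some column `β` is switched on in all of them. There
the singletons of `(β, t, some n)` lie in the given open sets, and the singleton of `(β, t, none)`
is a limit: within a column a switched character is either zero or equal to the unswitched one.

*Separation.* Countably many group elements involve only countably many requests, hence countably
many rows, while each background occurs in uncountably many rows of each class. So
every superposition of probes is realized on these elements (`exists_rowChar_eq_finsum`). In
a row class switched on at the columns of `x ≠ 0` some character is nonzero at `x`.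

*Density.* If a set meets only countably many columns, some row class is switched off on all of
them, and its characters vanish on the set, which is therefore not dense
(`not_countable_columns_of_dense`). In particular the group is not separable. A dense set therefore
contains a sequence `s n` each of whose terms meets a column missed by all earlier ones.
Given `x`, in a row class switched on at all the columns involved, a triangular system of equations
for the coefficients of the background yields a character which vanishes at `x` and equals `1` at
almost all `s n` (`exists_rowChar_eq_one_and_eq_zero`). So the sequence has no accumulation point,
and the group is not countably pracompact.
-/

/-! ### Characters of the group of finite sets -/

/-- The character of `[κ]^{<ω}` with prescribed values on singletons. -/
noncomputable def charSum {κ : Type*} [DecidableEq κ] (f : κ → ZMod 2) : FinsetGroup κ →+ ZMod 2 :=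
  AddMonoidHom.mk' (fun x => ∑ ξ ∈ ofBoolRing x, f ξ) (by
    intro x y
    rw [FinsetGroup.add_eq_symmDiff, ofBoolRing_toBoolRing]
    set s := ofBoolRing x
    set t := ofBoolRing y
    have hd : Disjoint (s \ t) (t \ s) := disjoint_sdiff_sdiff
    have h1 := Finset.sum_inter_add_sum_sdiff s t f
    have h2 := Finset.sum_inter_add_sum_sdiff t s f
    have h3 : ∑ ξ ∈ symmDiff s t, f ξ = ∑ ξ ∈ s \ t, f ξ + ∑ ξ ∈ t \ s, f ξ := by
      rw [← Finset.sum_union hd]; congr 1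
    rw [h3, ← h1, ← h2, Finset.inter_comm t s]
    have h4 := CharTwo.add_self_eq_zero (∑ ξ ∈ s ∩ t, f ξ)
    linear_combination -h4)

theorem charSum_apply {κ : Type*} [DecidableEq κ] (f : κ → ZMod 2) (x : FinsetGroup κ) :
    charSum f x = ∑ ξ ∈ ofBoolRing x, f ξ := rfl

theorem charSum_single {κ : Type*} [DecidableEq κ] (f : κ → ZMod 2) (ξ : κ) :
    charSum f (FinsetGroup.single ξ) = f ξ := by
  rw [charSum_apply, FinsetGroup.single, ofBoolRing_toBoolRing, Finset.sum_singleton]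

/-! ### Topologies generated by characters -/

section HomTopology

variable {G ι : Type*} [AddCommGroup G] {σ : ι → (G →+ ZMod 2)} [τ : TopologicalSpace G]

theorem isTopologicalAddGroup_of_homTopology (hτ : τ = homTopology σ) :
    IsTopologicalAddGroup G := by
  subst hτ
  let : TopologicalSpace (ZMod 2) := ⊥
  have : DiscreteTopology (ZMod 2) := ⟨rfl⟩
  exact topologicalAddGroup_iInf fun i => topologicalAddGroup_induced (σ i)

theorem isOpen_setOf_eq_of_homTopology (hτ : τ = homTopology σ) (i : ι) (c : ZMod 2) :
    IsOpen {z : G | σ i z = c} := by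
  subst hτ
  let : TopologicalSpace (ZMod 2) := ⊥
  have h : IsOpen[TopologicalSpace.induced (σ i) ⊥] {z : G | σ i z = c} :=
    ⟨{c}, trivial, rfl⟩
  exact (iInf_le (fun i => TopologicalSpace.induced (σ i) (⊥ : TopologicalSpace (ZMod 2))) i) _ h

theorem exists_finset_of_mem_nhds_homTopology (hτ : τ = homTopology σ) {a : G} {U : Set G}
    (hU : U ∈ 𝓝 a) : ∃ M : Finset ι, ∀ z, (∀ i ∈ M, σ i z = σ i a) → z ∈ U := by
  subst hτ
  rw [nhds_iInf, Filter.mem_iInf'] at hU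
  obtain ⟨M, hM, V, hV, -, rfl, -⟩ := hU
  refine ⟨hM.toFinset, fun z hz => ?_⟩
  refine mem_iInter₂.2 fun i hi => ?_
  have h := hV i
  rw [nhds_induced, @nhds_discrete _ ⊥ ⟨rfl⟩] at h
  obtain ⟨W, hW, hWV⟩ := h
  apply hWV
  have : σ i z = σ i a := hz i (hM.mem_toFinset.2 hi)
  simpa [this] using hW

theorem t2Space_of_homTopology (hτ : τ = homTopology σ)
    (h : ∀ x : G, x ≠ 0 → ∃ i, σ i x ≠ 0) : T2Space G := by
  refine ⟨fun x y hxy => ?_⟩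
  obtain ⟨i, hi⟩ := h (x - y) (sub_ne_zero.2 hxy)
  rw [map_sub, sub_ne_zero] at hi
  refine ⟨_, _, isOpen_setOf_eq_of_homTopology hτ i (σ i x),
    isOpen_setOf_eq_of_homTopology hτ i (σ i y), rfl, rfl, ?_⟩
  rw [Set.disjoint_left]
  intro z hz hz'
  exact hi (hz.symm.trans hz')

/-- A dense set cannot be contained in the kernel of one of the nonzero generating characters. -/
theorem exists_apply_ne_zero_of_dense (hτ : τ = homTopology σ) {D : Set G} (hD : Dense D) {i : ι}
    {x : G} (hx : σ i x ≠ 0) : ∃ d ∈ D, σ i d ≠ 0 := by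
  obtain ⟨d, hd, hdD⟩ :=
    hD.inter_open_nonempty _ (isOpen_setOf_eq_of_homTopology hτ i (σ i x)) ⟨x, rfl⟩
  exact ⟨d, hdD, fun h => hx (hd.symm.trans h)⟩

end HomTopology

/-! ### Existence of switching functions -/

theorem exists_isSwitchingFunction {κ : Type*} (hκ : Cardinal.mk κ = Cardinal.continuum) :
    ∃ F : κ × κ → Fin 2, IsSwitchingFunction F := by
  classical
  have hcard : Cardinal.mk κ = Cardinal.mk ((ℕ → κ) × Fin 2) := by simp [hκ]
  obtain ⟨e⟩ := Cardinal.eq.1 hcard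
  have hunc : Uncountable κ := by
    rw [← Cardinal.aleph0_lt_mk_iff, hκ]; exact Cardinal.aleph0_lt_continuum
  have hne : Nonempty κ := inferInstance
  -- The row `α` takes the value `(e α).2` on the range of `(e α).1`, and `1` elsewhere.
  have hrow : ∀ (i : Fin 2) (B : Set κ), B.Countable →
      ∃ α, ∀ β ∈ B, (if β ∈ range (e α).1 then (e α).2 else 1) = i := by
    intro i B hB
    obtain ⟨f, hf⟩ := (hB.insert hne.some).exists_eq_range (insert_nonempty _ _)
    refine ⟨e.symm (f, i), fun β hβ => ?_⟩
    simp [← hf, hβ]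
  refine ⟨fun q => if q.2 ∈ range (e q.1).1 then (e q.1).2 else 1, fun A hA => ?_,
    fun B hB => ⟨hrow 0 B hB, hrow 1 B hB⟩⟩
  have hc : (⋃ α ∈ A, range (e α).1).Countable := hA.biUnion fun _ _ => countable_range _
  obtain ⟨β, hβ⟩ : ∃ β, β ∉ ⋃ α ∈ A, range (e α).1 := by
    by_contra! h
    exact not_countable_univ (hc.mono fun x _ => h x)
  refine ⟨β, fun α hα => ?_⟩
  exact if_neg fun h => hβ (mem_biUnion hα h)

/-! ### The matrix of characters -/

/-- A sequence of requests. The pair `(M, N)` at position `n` asks the characters with index in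
`M` to take the value `1` if the index is in `N` and the value `0` otherwise. -/
abbrev Requests (κ : Type*) := ℕ → Finset κ × Finset κ

/-- The points on which the characters are defined: a point `(β, t, some n)` lies in the column `β`
and answers the request `t n`, and `(β, t, none)` is the limit of the points `(β, t, some n)`. -/
abbrev RequestPoint (κ : Type*) := κ × Requests κ × Option ℕ

/-- The limit of a sequence in `ZMod 2` along the hyperfilter on `ℕ`. -/
noncomputable def ultraLim (v : ℕ → ZMod 2) : ZMod 2 :=
  open scoped Classical in if ∀ᶠ n in (hyperfilter ℕ : Filter ℕ), v n = 1 then 1 else 0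

theorem eventually_eq_ultraLim (v : ℕ → ZMod 2) :
    ∀ᶠ n in (hyperfilter ℕ : Filter ℕ), v n = ultraLim v := by
  unfold ultraLim
  split_ifs with h
  · exact h
  · rw [← Ultrafilter.eventually_not] at h
    filter_upwards [h] with n hn
    revert hn
    generalize v n = a
    revert a
    decide

theorem ultraLim_eq_of_eventually_cofinite {v : ℕ → ZMod 2} {c : ZMod 2}
    (h : ∀ᶠ n in cofinite, v n = c) : ultraLim v = c := by
  obtain ⟨n, hn, hn'⟩ := ((eventually_eq_ultraLim v).and (hyperfilter_le_cofinite h)).exists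
  exact hn.symm.trans hn'

section Matrix

variable {κ : Type*}

/-- The character probing the point `q`: the indicator of `q` if `q` is not a limit point, and
the indicator of the whole sequence together with its limit if it is. In both cases it respects
the limits, and it is zero outside the column of `q`. -/
noncomputable def probe (q ξ : RequestPoint κ) : ZMod 2 :=
  open scoped Classical in
  if ξ.1 = q.1 ∧ ξ.2.1 = q.2.1 ∧ (q.2.2 = none ∨ ξ.2.2 = q.2.2) then 1 else 0

theorem probe_of_fst_ne {q ξ : RequestPoint κ} (h : ξ.1 ≠ q.1) : probe q ξ = 0 :=
  if_neg fun h' => h h'.1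

theorem eventually_probe_some_eq (q : RequestPoint κ) (β : κ) (t : Requests κ) :
    ∀ᶠ n in cofinite, probe q (β, t, some n) = probe q (β, t, none) := by
  obtain ⟨β', t', k⟩ := q
  cases k with
  | none =>
    classical
    exact Eventually.of_forall fun n =>
      if_congr ⟨fun h => ⟨h.1, h.2.1, Or.inl rfl⟩, fun h => ⟨h.1, h.2.1, Or.inl rfl⟩⟩ rfl rfl
  | some m =>
    filter_upwards [(finite_singleton m).compl_mem_cofinite] with n hn
    have : n ≠ m := hn
    simp [probe, this]

/-- The superposition of a sequence of probes `(e n).1` with coefficients `(e n).2`. -/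
noncomputable def background (e : ℕ → RequestPoint κ × ZMod 2) (ξ : RequestPoint κ) : ZMod 2 :=
  ∑ᶠ n, (e n).2 * probe (e n).1 ξ

/-- Only finitely many of the probes of `e` with nonzero coefficient live in each column. -/
def ColumnFinite (e : ℕ → RequestPoint κ × ZMod 2) : Prop :=
  ∀ β, {n | (e n).2 ≠ 0 ∧ (e n).1.1 = β}.Finite

theorem ColumnFinite.support_subset {e : ℕ → RequestPoint κ × ZMod 2} (ξ : RequestPoint κ) :
    (Function.support fun n => (e n).2 * probe (e n).1 ξ) ⊆
      {n | (e n).2 ≠ 0 ∧ (e n).1.1 = ξ.1} := by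
  intro n hn
  refine ⟨left_ne_zero_of_mul hn, ?_⟩
  by_contra h
  exact right_ne_zero_of_mul hn (probe_of_fst_ne fun h' => h h'.symm)

theorem ColumnFinite.eventually_background_some_eq {e : ℕ → RequestPoint κ × ZMod 2}
    (he : ColumnFinite e) (β : κ) (t : Requests κ) :
    ∀ᶠ n in cofinite, background e (β, t, some n) = background e (β, t, none) := by
  have hsum : ∀ k, background e (β, t, k) =
      ∑ m ∈ (he β).toFinset, (e m).2 * probe (e m).1 (β, t, k) := fun k =>
    finsum_eq_sum_of_support_subset _ (by
      simpa using ColumnFinite.support_subset (e := e) (β, t, k))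
  have hev : ∀ᶠ n in cofinite, ∀ m ∈ (he β).toFinset,
      probe (e m).1 (β, t, some n) = probe (e m).1 (β, t, none) :=
    (Filter.eventually_all_finset _).2 fun m _ => eventually_probe_some_eq _ _ _
  filter_upwards [hev] with n hn
  rw [hsum, hsum]
  exact Finset.sum_congr rfl fun m hm => by rw [hn m hm]

/-- The value of the character with index `μ` and background `e` at a point: the requested value at
a point whose request concerns `μ`, the limit of the values along the sequence at a limit point, and
the background value otherwise. -/
noncomputable def entry (μ : κ) (e : ℕ → RequestPoint κ × ZMod 2) : RequestPoint κ → ZMod 2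
  | (β, t, some n) => open scoped Classical in
      if μ ∈ (t n).1 then (if μ ∈ (t n).2 then 1 else 0) else background e (β, t, some n)
  | (β, t, none) => ultraLim fun n => open scoped Classical in
      if μ ∈ (t n).1 then (if μ ∈ (t n).2 then 1 else 0) else background e (β, t, some n)

theorem entry_some_of_mem {μ : κ} {e : ℕ → RequestPoint κ × ZMod 2} {β : κ} {t : Requests κ}
    {n : ℕ} [Decidable (μ ∈ (t n).2)] (h : μ ∈ (t n).1) :
    entry μ e (β, t, some n) = if μ ∈ (t n).2 then 1 else 0 := by
  simp [entry, h]

theorem eventually_entry_some_eq (μ : κ) (e : ℕ → RequestPoint κ × ZMod 2) (β : κ)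
    (t : Requests κ) :
    ∀ᶠ n in (hyperfilter ℕ : Filter ℕ), entry μ e (β, t, some n) = entry μ e (β, t, none) :=
  eventually_eq_ultraLim _

theorem entry_eq_background {μ : κ} {e : ℕ → RequestPoint κ × ZMod 2} (he : ColumnFinite e)
    {ξ : RequestPoint κ} (hμ : ∀ n, μ ∉ (ξ.2.1 n).1) : entry μ e ξ = background e ξ := by
  obtain ⟨β, t, k⟩ := ξ
  cases k with
  | some n => exact if_neg (hμ n)
  | none =>
    refine ultraLim_eq_of_eventually_cofinite ?_
    filter_upwards [he.eventually_background_some_eq β t] with n hn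
    rw [if_neg (hμ n), hn]

/-- Each finite set is detected, in any column which it meets, by some probe. -/
theorem exists_sum_probe_eq_one {s : Finset (RequestPoint κ)} {ξ : RequestPoint κ} (hξ : ξ ∈ s) :
    ∃ q : RequestPoint κ, q.1 = ξ.1 ∧ ∑ ζ ∈ s, probe q ζ = 1 := by
  classical
  obtain ⟨β, t, k⟩ := ξ
  by_cases h : ∃ n, (β, t, some n) ∈ s
  · obtain ⟨n, hn⟩ := h
    refine ⟨(β, t, some n), rfl, ?_⟩
    rw [Finset.sum_eq_single_of_mem _ hn]
    · simp [probe]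
    · rintro ⟨β', t', k'⟩ - hne
      refine if_neg ?_
      rintro ⟨rfl, rfl, h | h⟩
      · simp at h
      · exact hne (by rw [show k' = some n from h])
  · have hk : k = none := by
      cases k with
      | none => rfl
      | some n => exact absurd ⟨n, hξ⟩ h
    subst hk
    refine ⟨(β, t, none), rfl, ?_⟩
    rw [Finset.sum_eq_single_of_mem _ hξ]
    · simp [probe]
    · rintro ⟨β', t', k'⟩ hmem hne
      refine if_neg ?_
      rintro ⟨rfl, rfl, -⟩
      cases k' with
      | none => exact hne rfl
      | some n => exact h ⟨n, hmem⟩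

/-- A triangular system over `ZMod 2` with ones on the diagonal is solvable. -/
theorem exists_finsum_eq_one_of_triangular (c : ℕ → ℕ → ZMod 2) (hdiag : ∀ n, c n n = 1)
    (htri : ∀ m n, n < m → c m n = 0) :
    ∃ a : ℕ → ZMod 2, ∀ n, ∑ᶠ m, a m * c m n = 1 := by
  let a : ℕ → ZMod 2 := fun n => Nat.strongRec (motive := fun _ => ZMod 2)
    (fun n ih => 1 - ∑ m : Fin n, ih m m.2 * c m n) n
  have ha : ∀ n, a n = 1 - ∑ m : Fin n, a m * c m n := fun n => by
    simp only [a]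
    rw [Nat.strongRec_eq]
  refine ⟨a, fun n => ?_⟩
  rw [finsum_eq_sum_of_support_subset (s := Finset.range (n + 1)), Finset.sum_range_succ, hdiag,
    mul_one, ha n, Finset.sum_range]
  · ring
  · intro m hm
    by_contra h
    simp only [Finset.coe_range, mem_Iio, not_lt] at h
    exact hm (by simp [htri m n h])

end Matrix

/-! ### The characters indexed by rows -/

/-- The index of a character: its row class `α`, its background, and a label which provides
uncountably many copies of each. -/
abbrev RowIndex (κ : Type*) := κ × (ℕ → RequestPoint κ × ZMod 2) × κ

section Rows

variable {κ : Type*} [DecidableEq κ] (r : κ ≃ RowIndex κ) (c : κ ≃ RequestPoint κ)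

/-- The character with index `μ`, where points and indices are coded by elements of `κ`. -/
noncomputable def rowChar (μ : κ) : FinsetGroup κ →+ ZMod 2 :=
  charSum fun ξ => entry μ (r μ).2.1 (c ξ)

/-- The probe of the point `q` as a character. -/
noncomputable def probeChar (q : RequestPoint κ) : FinsetGroup κ →+ ZMod 2 :=
  charSum fun ξ => probe q (c ξ)

variable {c} in
theorem probeChar_eq_zero {q : RequestPoint κ} {x : FinsetGroup κ}
    (h : ∀ ξ ∈ ofBoolRing x, (c ξ).1 ≠ q.1) : probeChar c q x = 0 :=
  Finset.sum_eq_zero fun ξ hξ => probe_of_fst_ne (h ξ hξ)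

theorem exists_probeChar_eq_one {x : FinsetGroup κ} {ξ : κ} (hξ : ξ ∈ ofBoolRing x) :
    ∃ q : RequestPoint κ, q.1 = (c ξ).1 ∧ probeChar c q x = 1 := by
  obtain ⟨q, hq, h⟩ := exists_sum_probe_eq_one
    (Finset.mem_map_of_mem c.toEmbedding hξ)
  refine ⟨q, hq, ?_⟩
  rwa [Finset.sum_map] at h

/-- In every row class there is a character that agrees on a given countable set of group
elements with a prescribed superposition of probes. The requests at the points involved concern only
countably many indices, and each superposition has uncountably many indices. -/
theorem exists_rowChar_eq_finsum [Uncountable κ] (α : κ) {e : ℕ → RequestPoint κ × ZMod 2}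
    (he : ColumnFinite e) {X : Set (FinsetGroup κ)} (hX : X.Countable) :
    ∃ μ, (r μ).1 = α ∧
      ∀ x ∈ X, rowChar r c μ x = ∑ᶠ n, (e n).2 * probeChar c (e n).1 x := by
  let bad : Set κ := ⋃ x ∈ X, ⋃ ξ ∈ ofBoolRing x, ⋃ n, (((c ξ).2.1 n).1 : Set κ)
  have hbad : bad.Countable := hX.biUnion fun x _ =>
    (ofBoolRing x).countable_toSet.biUnion fun ξ _ =>
      countable_iUnion fun n => Finset.countable_toSet _
  have hinj : Function.Injective fun δ : κ => r.symm (α, e, δ) := fun δ δ' h => by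
    simpa using h
  obtain ⟨δ, hδ⟩ : ∃ δ, r.symm (α, e, δ) ∉ bad := by
    by_contra! h
    exact not_countable_univ ((hbad.preimage hinj).mono fun δ _ => h δ)
  refine ⟨r.symm (α, e, δ), by simp, fun x hx => ?_⟩
  have hentry : ∀ ξ ∈ ofBoolRing x,
      entry (r.symm (α, e, δ)) e (c ξ) = ∑ᶠ n, (e n).2 * probe (e n).1 (c ξ) := fun ξ hξ =>
    entry_eq_background he fun n hn => hδ
      (mem_biUnion hx (mem_biUnion (t := fun ξ => ⋃ n, (((c ξ).2.1 n).1 : Set κ)) hξ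
        (mem_iUnion.2 ⟨n, hn⟩)))
  rw [rowChar, charSum_apply]
  simp only [Equiv.apply_symm_apply]
  rw [Finset.sum_congr rfl hentry, ← finsum_sum_comm]
  · exact finsum_congr fun n => by rw [probeChar, charSum_apply, Finset.mul_sum]
  · exact fun ξ _ => (he (c ξ).1).subset (ColumnFinite.support_subset (c ξ))

theorem exists_rowChar_ne_zero [Uncountable κ] (α : κ) {x : FinsetGroup κ} (hx : x ≠ 0) :
    ∃ μ, (r μ).1 = α ∧ rowChar r c μ x ≠ 0 := by
  have hne : (ofBoolRing x).Nonempty := by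
    rw [Finset.nonempty_iff_ne_empty]
    exact hx
  obtain ⟨ξ, hξ⟩ := hne
  obtain ⟨q, -, hq⟩ := exists_probeChar_eq_one c hξ
  have he : ColumnFinite fun n : ℕ => (q, if n = 0 then (1 : ZMod 2) else 0) := fun β =>
    (finite_singleton 0).subset fun n hn => by
      by_contra h
      exact hn.1 (if_neg h)
  obtain ⟨μ, hμ, h⟩ := exists_rowChar_eq_finsum r c α he (countable_singleton x)
  refine ⟨μ, hμ, ?_⟩
  rw [h x rfl, finsum_eq_single _ 0 (by intro n hn; simp [hn])]
  simp [hq]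

/-- Let each `s n` meet a column `col n` missed by `x` and by all earlier terms. Then
in every row class there is a character vanishing at `x` and equal to `1` at all `s n`. -/
theorem exists_rowChar_eq_one_and_eq_zero [Uncountable κ] (α : κ) (s : ℕ → FinsetGroup κ)
    (x : FinsetGroup κ) (col : ℕ → κ) (hmem : ∀ n, ∃ ξ ∈ ofBoolRing (s n), (c ξ).1 = col n)
    (hnew : ∀ m n, n < m → ∀ ξ ∈ ofBoolRing (s n), (c ξ).1 ≠ col m)
    (hx : ∀ n, ∀ ξ ∈ ofBoolRing x, (c ξ).1 ≠ col n) :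
    ∃ μ, (r μ).1 = α ∧ rowChar r c μ x = 0 ∧ ∀ n, rowChar r c μ (s n) = 1 := by
  have hq : ∀ n, ∃ q : RequestPoint κ, q.1 = col n ∧ probeChar c q (s n) = 1 := fun n => by
    obtain ⟨ξ, hξ, hcol⟩ := hmem n
    rw [← hcol]
    exact exists_probeChar_eq_one c hξ
  choose q hqcol hqone using hq
  have hinj : Function.Injective col := by
    refine Function.Injective.of_lt_imp_ne fun n m hnm h => ?_
    obtain ⟨ξ, hξ, hcol⟩ := hmem n
    exact hnew m n hnm ξ hξ (hcol.trans h)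
  obtain ⟨a, ha⟩ := exists_finsum_eq_one_of_triangular (fun m n => probeChar c (q m) (s n)) hqone
    fun m n hnm => probeChar_eq_zero fun ξ hξ => by rw [hqcol]; exact hnew m n hnm ξ hξ
  have he : ColumnFinite fun n : ℕ => (q n, a n) := fun β =>
    Set.Subsingleton.finite fun n hn m hm => hinj (by
      rw [← hqcol n, ← hqcol m]
      exact hn.2.trans hm.2.symm)
  obtain ⟨μ, hμ, h⟩ := exists_rowChar_eq_finsum r c α he ((countable_range s).insert x)
  refine ⟨μ, hμ, ?_, fun n => (h _ (mem_insert_of_mem _ ⟨n, rfl⟩)).trans (ha n)⟩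
  rw [h x (mem_insert _ _)]
  refine finsum_eq_zero_of_forall_eq_zero fun n => ?_
  rw [probeChar_eq_zero fun ξ hξ => by rw [hqcol]; exact hx n ξ hξ, mul_zero]

end Rows

/-! ### The switched topology -/

section Columns

variable {κ : Type*} (c : κ ≃ RequestPoint κ)

/-- The columns met by some element of a set `D`. -/
def columns (D : Set (FinsetGroup κ)) : Set κ :=
  ⋃ x ∈ D, (fun ξ => (c ξ).1) '' ((ofBoolRing x : Finset κ) : Set κ)

variable {c} in
theorem mem_columns {D : Set (FinsetGroup κ)} {x : FinsetGroup κ} (hx : x ∈ D) {ξ : κ}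
    (hξ : ξ ∈ ofBoolRing x) : (c ξ).1 ∈ columns c D :=
  mem_biUnion hx ⟨ξ, hξ, rfl⟩

theorem countable_columns {D : Set (FinsetGroup κ)} (hD : D.Countable) :
    (columns c D).Countable :=
  hD.biUnion fun x _ => (ofBoolRing x).countable_toSet.image _

end Columns

section Switched

variable {κ : Type*} [DecidableEq κ] (r : κ ≃ RowIndex κ) (c : κ ≃ RequestPoint κ)
  (F : κ × κ → Fin 2)

/-- The character `rowChar` switched off at the points in the columns where `F` vanishes. -/
noncomputable def switchedChar (μ : κ) : FinsetGroup κ →+ ZMod 2 :=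
  charSum fun ξ => if F ((r μ).1, (c ξ).1) = 0 then 0 else entry μ (r μ).2.1 (c ξ)

theorem switchedChar_single (μ ξ : κ) :
    switchedChar r c F μ (FinsetGroup.single ξ) =
      if F ((r μ).1, (c ξ).1) = 0 then 0 else rowChar r c μ (FinsetGroup.single ξ) := by
  rw [switchedChar, rowChar, charSum_single, charSum_single]

variable {F}

theorem switchedChar_of_forall_eq_one {μ : κ} {x : FinsetGroup κ}
    (h : ∀ ξ ∈ ofBoolRing x, F ((r μ).1, (c ξ).1) = 1) :
    switchedChar r c F μ x = rowChar r c μ x :=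
  Finset.sum_congr rfl fun ξ hξ => if_neg (by rw [h ξ hξ]; decide)

theorem switchedChar_of_forall_eq_zero {μ : κ} {x : FinsetGroup κ}
    (h : ∀ ξ ∈ ofBoolRing x, F ((r μ).1, (c ξ).1) = 0) : switchedChar r c F μ x = 0 :=
  Finset.sum_eq_zero fun ξ hξ => if_pos (h ξ hξ)

theorem exists_switchedChar_ne_zero [Uncountable κ] (hF : IsSwitchingFunction F)
    {x : FinsetGroup κ} (hx : x ≠ 0) :
    ∃ μ, switchedChar r c F μ x ≠ 0 := by
  obtain ⟨-, α, hα⟩ := hF.2 _ (countable_columns c (countable_singleton x))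
  obtain ⟨μ, rfl, h⟩ := exists_rowChar_ne_zero r c α hx
  refine ⟨μ, ?_⟩
  rwa [switchedChar_of_forall_eq_one]
  exact fun ξ hξ => hα _ (mem_columns (mem_singleton x) hξ)

variable [τ : TopologicalSpace (FinsetGroup κ)]

/-- A dense set meets uncountably many columns. -/
theorem not_countable_columns_of_dense [Uncountable κ] (hF : IsSwitchingFunction F)
    (hτ : τ = homTopology (switchedChar r c F))
    {D : Set (FinsetGroup κ)} (hD : Dense D) :
    ¬ (columns c D).Countable := by
  intro hcount
  obtain ⟨⟨α, hα⟩, -⟩ := hF.2 _ hcount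
  obtain ⟨β, hβ⟩ := hF.1 {α} (countable_singleton α)
  let ξ : κ := c.symm (β, fun _ => (∅, ∅), none)
  have hξ : FinsetGroup.single ξ ≠ 0 := fun h =>
    Finset.singleton_ne_empty ξ (toBoolRing.injective h)
  obtain ⟨μ, rfl, hμ⟩ := exists_rowChar_ne_zero r c α hξ
  have hne : switchedChar r c F μ (FinsetGroup.single ξ) ≠ 0 := by
    rw [switchedChar_single, if_neg]
    · exact hμ
    · simp [ξ, hβ]
  obtain ⟨d, hd, hd'⟩ := exists_apply_ne_zero_of_dense hτ hD hne
  exact hd' (switchedChar_of_forall_eq_zero r c fun ξ hξ => hα _ (mem_columns hd hξ))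

theorem not_separableSpace_switched [Uncountable κ] (hF : IsSwitchingFunction F)
    (hτ : τ = homTopology (switchedChar r c F)) :
    ¬ TopologicalSpace.SeparableSpace (FinsetGroup κ) := by
  rintro ⟨D, hD, hdense⟩
  exact not_countable_columns_of_dense r c hF hτ hdense (countable_columns c hD)

theorem selectivelyPseudocompact_switched (hF : IsSwitchingFunction F)
    (hτ : τ = homTopology (switchedChar r c F)) :
    SelectivelyPseudocompact (FinsetGroup κ) := by
  intro U hU
  choose y hy using fun n => (hU n).2
  choose M hM using fun n =>
    exists_finset_of_mem_nhds_homTopology hτ ((hU n).1.mem_nhds (hy n))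
  obtain ⟨β, hβ⟩ := hF.1 ((fun μ => (r μ).1) '' ⋃ n, (M n : Set κ))
    ((countable_iUnion fun n => (M n).countable_toSet).image _)
  -- The requests asking for membership in the sets `U n`, answered in the column `β`.
  let t : Requests κ := fun n => (M n, (M n).filter fun μ => switchedChar r c F μ (y n) = 1)
  have hval : ∀ μ k, switchedChar r c F μ (FinsetGroup.single (c.symm (β, t, k))) =
      if F ((r μ).1, β) = 0 then 0 else entry μ (r μ).2.1 (β, t, k) := fun μ k => by
    rw [switchedChar_single, rowChar, charSum_single, Equiv.apply_symm_apply]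
  refine ⟨fun n => FinsetGroup.single (c.symm (β, t, some n)),
    FinsetGroup.single (c.symm (β, t, none)), hyperfilter ℕ, ?_, ?_, ?_⟩
  · intro n h
    have h1 : {n}ᶜ ∈ hyperfilter ℕ := (finite_singleton n).compl_mem_hyperfilter
    rw [h] at h1
    exact h1 rfl
  · intro V hV
    obtain ⟨N, hN⟩ := exists_finset_of_mem_nhds_homTopology hτ hV
    have hev : ∀ᶠ n in (hyperfilter ℕ : Filter ℕ), ∀ μ ∈ N,
        entry μ (r μ).2.1 (β, t, some n) = entry μ (r μ).2.1 (β, t, none) :=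
      (Filter.eventually_all_finset _).2 fun μ _ => eventually_entry_some_eq _ _ _ _
    filter_upwards [hev] with n hn
    refine hN _ fun μ hμ => ?_
    rw [hval, hval, hn μ hμ]
  · intro n
    refine hM n _ fun μ hμ => ?_
    have h1 : F ((r μ).1, β) = 1 := hβ _ ⟨μ, mem_iUnion.2 ⟨n, hμ⟩, rfl⟩
    rw [hval, h1, if_neg (by decide), entry_some_of_mem hμ]
    simp only [t, Finset.mem_filter, hμ, true_and]
    generalize switchedChar r c F μ (y n) = a
    revert a
    decide

theorem not_countablyPracompact_switched [Uncountable κ] (hF : IsSwitchingFunction F)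
    (hτ : τ = homTopology (switchedChar r c F)) :
    ¬ CountablyPracompact (FinsetGroup κ) := by
  rintro ⟨D, hD, hacc⟩
  have := t2Space_of_homTopology hτ fun x hx => exists_switchedChar_ne_zero r c hF hx
  -- A sequence in `D` each of whose terms meets a column missed by all the earlier ones.
  obtain ⟨f, hf, hnew⟩ := exists_seq_of_forall_finset_exists
    (fun d : FinsetGroup κ × κ => d.1 ∈ D ∧ ∃ ξ ∈ ofBoolRing d.1, (c ξ).1 = d.2)
    (fun d d' => ∀ ξ ∈ ofBoolRing d.1, (c ξ).1 ≠ d'.2) (fun l _ => by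
      by_contra! h
      refine not_countable_columns_of_dense r c hF hτ hD
        ((countable_columns c (l.countable_toSet.image Prod.fst)).mono fun β hβ => ?_)
      obtain ⟨d, hd, ξ, hξ, rfl⟩ := mem_iUnion₂.1 hβ
      obtain ⟨d', hd', ζ, hζ, hcol⟩ := h (d, (c ξ).1) ⟨hd, ξ, hξ, rfl⟩
      change (c ζ).1 = (c ξ).1 at hcol
      change (c ξ).1 ∈ _
      rw [← hcol]
      exact mem_columns (mem_image_of_mem Prod.fst hd') hζ)
  have hinj : Function.Injective fun n => (f n).1 :=
    Function.Injective.of_lt_imp_ne fun n m hnm h => by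
      obtain ⟨ξ, hξ, hcol⟩ := (hf m).2
      rw [← show (f n).1 = (f m).1 from h] at hξ
      exact hnew n m hnm ξ hξ hcol
  have hcolinj : Function.Injective fun n => (f n).2 :=
    Function.Injective.of_lt_imp_ne fun n m hnm h => by
      obtain ⟨ξ, hξ, hcol⟩ := (hf n).2
      exact hnew n m hnm ξ hξ (hcol.trans h)
  obtain ⟨x, hx⟩ := hacc (range fun n => (f n).1) (range_subset_iff.2 fun n => (hf n).1)
    (infinite_range_of_injective hinj)
  -- In a row switched on at all columns involved, the character below separates `x` from a tail.
  obtain ⟨-, α, hα⟩ := hF.2 _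
    (countable_columns c ((countable_range fun n => (f n).1).insert x))
  obtain ⟨k, hk⟩ : ∃ k, ∀ n, k ≤ n → ∀ ξ ∈ ofBoolRing x, (c ξ).1 ≠ (f n).2 := by
    have hfin : ((fun n => (f n).2) ⁻¹' ((ofBoolRing x).image fun ξ => (c ξ).1 : Finset κ)).Finite :=
      (Finset.finite_toSet _).preimage hcolinj.injOn
    obtain ⟨k, hk⟩ := hfin.bddAbove
    refine ⟨k + 1, fun n hn ξ hξ h => ?_⟩
    have := hk (show n ∈ _ from Finset.mem_coe.2 (Finset.mem_image.2 ⟨ξ, hξ, h⟩))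
    omega
  obtain ⟨μ, rfl, hμx, hμ⟩ := exists_rowChar_eq_one_and_eq_zero r c α (fun n => (f (k + n)).1) x
    (fun n => (f (k + n)).2) (fun n => (hf _).2) (fun m n h => hnew _ _ (by omega))
    (fun n => hk _ (by omega))
  have hV : {z | switchedChar r c F μ z = 0} ∈ 𝓝 x := by
    refine (isOpen_setOf_eq_of_homTopology hτ μ 0).mem_nhds ?_
    rw [mem_ofPred_eq, switchedChar_of_forall_eq_one, hμx]
    exact fun ξ hξ => hα _ (mem_columns (mem_insert _ _) hξ)
  have hW : ((fun n => (f n).1) '' Iio k \ {x})ᶜ ∈ 𝓝 x :=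
    (((finite_Iio k).image _).subset sdiff_subset).isClosed.isOpen_compl.mem_nhds
      fun h => h.2 rfl
  obtain ⟨y, ⟨⟨hyV, hyW⟩, ⟨n, rfl⟩⟩, hyx⟩ := accPt_iff_nhds.1 hx _ (inter_mem hV hW)
  have hn : k ≤ n := by
    by_contra! h
    exact hyW ⟨⟨n, h, rfl⟩, hyx⟩
  obtain ⟨m, rfl⟩ := Nat.exists_eq_add_of_le hn
  rw [mem_ofPred_eq, switchedChar_of_forall_eq_one, hμ] at hyV
  · exact one_ne_zero hyV
  · exact fun ξ hξ => hα _ (mem_columns (mem_insert_of_mem _ (mem_range_self (k + m))) hξ)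

end Switched

/-! ### Assembling the group -/

theorem mk_preimage_fst_singleton.{u} {α β γ : Type u} (e : α ≃ β × γ) (b : β) :
    Cardinal.mk ((fun a => (e a).1) ⁻¹' {b} : Set α) = Cardinal.mk γ :=
  Cardinal.mk_congr
    { toFun := fun a => (e a).2
      invFun := fun g => ⟨e.symm (b, g), by simp⟩
      left_inv := fun ⟨a, ha⟩ => Subtype.ext (by
        have h : (e a).1 = b := ha
        simp [← h])
      right_inv := fun g => by simp }

theorem mainTheorem3 {κ : Type*} [DecidableEq κ] (hκ : Cardinal.mk κ = Cardinal.continuum) :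
    (∃ F : κ × κ → Fin 2, IsSwitchingFunction F) ∧
    ∃ I J : κ → κ,
      (∀ α, Cardinal.mk (I ⁻¹' {α} : Set κ) = Cardinal.continuum) ∧
      (∀ β, Cardinal.mk (J ⁻¹' {β} : Set κ) = Cardinal.continuum) ∧
      ∃ ψ : κ → (FinsetGroup κ →+ ZMod 2),
        ∀ F : κ × κ → Fin 2, IsSwitchingFunction F →
          ∃ σ : κ → (FinsetGroup κ →+ ZMod 2),
            (∀ μ ξ, σ μ (FinsetGroup.single ξ) =
              if F (I μ, J ξ) = 0 then 0 else ψ μ (FinsetGroup.single ξ)) ∧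
            ∃ τ : TopologicalSpace (FinsetGroup κ), τ = homTopology σ ∧
              (∀ x : FinsetGroup κ, x + x = 0) ∧
              IsTopologicalAddGroup (FinsetGroup κ) ∧
              T2Space (FinsetGroup κ) ∧
              SelectivelyPseudocompact (FinsetGroup κ) ∧
              ¬ CountablyPracompact (FinsetGroup κ) ∧
              ¬ TopologicalSpace.SeparableSpace (FinsetGroup κ) := by
  refine ⟨exists_isSwitchingFunction hκ, ?_⟩
  have : Uncountable κ := by
    rw [← Cardinal.aleph0_lt_mk_iff, hκ]; exact Cardinal.aleph0_lt_continuum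
  have hreq : Cardinal.mk (Requests κ × Option ℕ) = Cardinal.continuum := by
    simp [hκ]
  have hpoint : Cardinal.mk (RequestPoint κ) = Cardinal.continuum := by
    rw [Cardinal.mk_prod, hreq, hκ]; simp
  have hback : Cardinal.mk ((ℕ → RequestPoint κ × ZMod 2) × κ) = Cardinal.continuum := by
    have : Cardinal.mk (RequestPoint κ × ZMod 2) = Cardinal.continuum := by
      rw [Cardinal.mk_prod, hpoint]; simp
    rw [Cardinal.mk_prod, Cardinal.mk_pi, Cardinal.prod_const, this, hκ]; simp
  have hrow : Cardinal.mk (RowIndex κ) = Cardinal.continuum := by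
    rw [Cardinal.mk_prod, hback, hκ]; simp
  obtain ⟨r⟩ := Cardinal.eq.1 (hκ.trans hrow.symm)
  obtain ⟨c⟩ := Cardinal.eq.1 (hκ.trans hpoint.symm)
  refine ⟨fun μ => (r μ).1, fun ξ => (c ξ).1, fun α => ?_, fun β => ?_, rowChar r c,
    fun F hF => ⟨switchedChar r c F, switchedChar_single r c F, homTopology _, rfl, ?_⟩⟩
  · rw [mk_preimage_fst_singleton, hback]
  · rw [mk_preimage_fst_singleton, hreq]
  · let τ : TopologicalSpace (FinsetGroup κ) := homTopology (switchedChar r c F)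
    exact ⟨fun x => congrArg toBoolRing (symmDiff_self (ofBoolRing x)),
      isTopologicalAddGroup_of_homTopology rfl,
      t2Space_of_homTopology rfl fun x hx => exists_switchedChar_ne_zero r c hF hx,
      selectivelyPseudocompact_switched r c hF rfl,
      not_countablyPracompact_switched r c hF rfl,
      not_separableSpace_switched r c hF rfl⟩
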